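/- Consider a data re-uploading quantum neural network on $N$ qubits with $L\ge 1$ layers for data $\bm x\in\mathbb R^D$, $D\ge1$. Its circuit is the unitary $$U(\bm\theta,\bm x)=W_L(\bm\theta^{(L)})\,E(\bm x)\,W_{L-1}(\bm\theta^{(L-1)})\cdots W_1(\bm\theta^{(1)})\,E(\bm x)\,W_0(\bm\theta^{(0)}),$$ where $E(\bm x)$ is a (measurable) data-encoding unitary and each trainable block $W_l$ is an ordered product of arbitrary fixed unitaries and single-qubit Pauli rotations $e^{-i\theta P/2}$, $P\in\{X,Y,Z\}$, one for each of its trainable parameters; $K$ is the total number of trainable parameters. With an input density matrix $\rho_{in}$ and a Hermitian observable $\mathcal M$ of operator norm $\|\mathcal M\|_\infty$, the output is $f(\bm\theta,\bm x)=\mathrm{tr}[\mathcal M\,U(\bm\theta,\bm x)\rho_{in}U(\bm\theta,\bm x)^\dagger]$. Let $\ell(a,y)$ be a loss function (of the prediction $a$ and the label $y$) such that, for every label $y$ that occurs, on an interval containing all outputs of the network, $a\mapsto\ell(a,y)$ is $\mathcal C_1$-Lipschitz, differentiable with $\mathcal C_2$-Lipschitz derivative, and $0\le\ell\le M$. Let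 $S=\{(\bm x_i,y_i)\}_{i=1}^m$, $m\ge1$, be drawn i.i.d. from a probability distribution $\mathbb D$ on $\mathbb R^D\times\mathbb R$, and let $\mathcal A_S$ be the network with the parameters obtained from a fixed initial parameter vector by $T$ steps of stochastic gradient descent $\theta^{(j)}\leftarrow\theta^{(j)}-\eta\,\partial_{\theta^{(j)}}\ell(f(\bm\theta,\bm x_i),y_i)$, $j=1,\dots,K$, with learning rate $\eta>0$, the index $i$ being chosen uniformly at random and independently at each step. Let $R(\mathcal A_S)=\mathbb E_{(\bm x,y)\sim\mathbb D}[\ell(f_{\mathcal A_S}(\bm x),y)]$ and $\hat R(\mathcal A_S)=\frac1m\sum_{i=1}^m\ell(f_{\mathcal A_S}(\bm x_i),y_i)$, and let $\mathbb E_{\mathrm{SGD}}$ be the expectation over the random indices. Then for every $\delta\in(0,1)$, with probability at least $1-\delta$ over the draw of $S$, $$\mathbb E_{\mathrm{SGD}}[R(\mathcal A_S)-\hat R(\mathcal A_S)]\le\frac{LD\|\mathcal M\|_\infty}{m}\,g_T(\eta K\|\mathcal M\|_\infty)+\Big(LD\|\mathcal M\|_\infty\, g_T(\eta K\|\mathcal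 M\|_\infty)+M\Big)\sqrt{\frac{\log\frac1\delta}{2m}},$$ where the functions $g_T:\mathbb R\to\mathbb R$ depend only on $\mathcal C_1$ and $\mathcal C_2$, and $g_T(u)=\mathcal O(u^{T})$ as $u\to\infty$, uniformly in $T\in\{0,1,2,\dots\}$ (that is, there are $C,u_0$ depending only on $\mathcal C_1,\mathcal C_2$ with $|g_T(u)|\le C u^T$ for all $T$ and all $u\ge u_0$). -/

import Mathlib

open MeasureTheory Filter Asymptotics
open scoped NNReal ENNReal ComplexOrder

noncomputable section

namespace QNN

/-- Index set of the computational basis of `N` qubits (it has `2 ^ N` elements). -/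
abbrev Basis (N : ℕ) : Type := Fin N → Fin 2

/-- Operators on the Hilbert space of `N` qubits. -/
abbrev Op (N : ℕ) : Type := Matrix (Basis N) (Basis N) ℂ

/-- The Schatten-`∞` norm, that is, the operator norm on the Hilbert space `ℂ ^ (2 ^ N)`. -/
def opNorm {N : ℕ} (A : Op N) : ℝ :=
  ‖Matrix.toEuclideanCLM (n := Basis N) (𝕜 := ℂ) A‖

/-- Labels of the three Pauli matrices. -/
inductive Pauli : Type where
  | X : Pauli
  | Y : Pauli
  | Z : Pauli

/-- The Pauli matrices. -/
def Pauli.toMatrix : Pauli → Matrix (Fin 2) (Fin 2) ℂ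
  | Pauli.X => !![0, 1; 1, 0]
  | Pauli.Y => !![0, -Complex.I; Complex.I, 0]
  | Pauli.Z => !![1, 0; 0, -1]

/-- The Pauli matrix `P` on qubit `q`, tensored with the identity on all other qubits. -/
def pauliOn {N : ℕ} (q : Fin N) (P : Pauli) : Op N :=
  Matrix.of fun a b =>
    ∏ k : Fin N, (if k = q then P.toMatrix else 1 : Matrix (Fin 2) (Fin 2) ℂ) (a k) (b k)

/-- The rotation gate `exp (-i α P / 2)` on qubit `q`. -/
def rotation {N : ℕ} (q : Fin N) (P : Pauli) (α : ℝ) : Op N :=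
  NormedSpace.exp ((-(Complex.I * (α : ℂ) / 2)) • pauliOn q P)

/-- A trainable block with `n` parameters on `N` qubits: single-qubit Pauli rotations, one for
each parameter, interleaved with fixed unitary gates. -/
structure TrainableBlock (N n : ℕ) where
  /-- the fixed gate standing to the left of the `k`-th rotation -/
  gate : Fin n → Matrix.unitaryGroup (Basis N) ℂ
  /-- the fixed gate standing to the right of all rotations -/
  last : Matrix.unitaryGroup (Basis N) ℂ
  /-- the qubit on which the `k`-th rotation acts -/
  qubit : Fin n → Fin N
  /-- the Pauli matrix generating the `k`-th rotation -/
  axis : Fin n → Pauli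

/-- The unitary `(∏ k, U_k exp (-i α_k P_k / 2)) V` of a trainable block (ordered product). -/
def TrainableBlock.toOp {N n : ℕ} (W : TrainableBlock N n) (α : Fin n → ℝ) : Op N :=
  (List.ofFn fun k : Fin n =>
    (W.gate k : Op N) * rotation (W.qubit k) (W.axis k) (α k)).prod * (W.last : Op N)

/-- An `L`-layer data re-uploading quantum neural network on `N` qubits, for data in `ℝ ^ D`.
The `L + 1` trainable blocks, the `l`-th one with `n l` parameters, are interspersed with `L`
uploads of the data by the same encoding unitary. -/
structure ReuploadingQNN (N L D : ℕ) (n : Fin (L + 1) → ℕ) where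
  /-- the input state, a density matrix -/
  rho : Op N
  rho_posSemidef : rho.PosSemidef
  rho_trace : rho.trace = 1
  /-- the trainable blocks, in the order in which they act -/
  block : (l : Fin (L + 1)) → TrainableBlock N (n l)
  /-- the data-encoding unitary -/
  encode : (Fin D → ℝ) → Matrix.unitaryGroup (Basis N) ℂ
  encode_measurable : ∀ a b : Basis N, Measurable fun x => (encode x : Op N) a b
  /-- the measured observable -/
  obs : Op N
  obs_hermitian : obs.IsHermitian

/-- Parameter vectors: one real number for every rotation of every block. -/
abbrev Params {L : ℕ} (n : Fin (L + 1) → ℕ) : Type := (Σ l : Fin (L + 1), Fin (n l)) → ℝ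

/-- The number `K` of trainable parameters. -/
def numParams {L : ℕ} (n : Fin (L + 1) → ℕ) : ℕ := ∑ l, n l

namespace ReuploadingQNN

variable {N L D : ℕ} {n : Fin (L + 1) → ℕ}

/-- The unitary of the `l`-th trainable block, evaluated at its share of the parameters. -/
def blockOp (Q : ReuploadingQNN N L D n) (θ : Params n) (l : Fin (L + 1)) : Op N :=
  (Q.block l).toOp fun k => θ ⟨l, k⟩

/-- The unitary `W_L E(x) W_{L-1} E(x) ⋯ W_1 E(x) W_0` of the whole circuit. -/
def circuit (Q : ReuploadingQNN N L D n) (θ : Params n) (x : Fin D → ℝ) : Op N :=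
  (List.ofFn fun l : Fin L => Q.blockOp θ l.succ * (Q.encode x : Op N)).reverse.prod
    * Q.blockOp θ 0

/-- The output `tr (ℳ U ρ U†)` of the network. It is real because the observable is Hermitian. -/
def output (Q : ReuploadingQNN N L D n) (θ : Params n) (x : Fin D → ℝ) : ℝ :=
  (Q.obs * (Q.circuit θ x * Q.rho * (Q.circuit θ x).conjTranspose)).trace.re

/-- The loss `ℓ (f (θ, x), y)` at the example `z = (x, y)`. -/
def lossAt (Q : ReuploadingQNN N L D n) (ℓ : ℝ → ℝ → ℝ) (θ : Params n)
    (z : (Fin D → ℝ) × ℝ) : ℝ :=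
  ℓ (Q.output θ z.1) z.2

/-- One gradient step with learning rate `η` on the example `z`. -/
def sgdStep (Q : ReuploadingQNN N L D n) (ℓ : ℝ → ℝ → ℝ) (η : ℝ) (θ : Params n)
    (z : (Fin D → ℝ) × ℝ) : Params n :=
  fun j => θ j - η * deriv (fun s : ℝ => Q.lossAt ℓ (Function.update θ j s) z) (θ j)

/-- The parameters after `T` steps started at `θ₀`, when the `t`-th step uses the training
example number `σ t`. -/
def sgdRun (Q : ReuploadingQNN N L D n) (ℓ : ℝ → ℝ → ℝ) (η : ℝ) (θ₀ : Params n)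
    {m T : ℕ} (S : Fin m → (Fin D → ℝ) × ℝ) (σ : Fin T → Fin m) : Params n :=
  (List.ofFn σ).foldl (fun θ i => Q.sgdStep ℓ η θ (S i)) θ₀

/-- The expected risk. -/
def risk (Q : ReuploadingQNN N L D n) (ℓ : ℝ → ℝ → ℝ) (P : Measure ((Fin D → ℝ) × ℝ))
    (θ : Params n) : ℝ :=
  ∫ z, Q.lossAt ℓ θ z ∂P

/-- The empirical risk on the training set `S`. -/
def empiricalRisk (Q : ReuploadingQNN N L D n) (ℓ : ℝ → ℝ → ℝ) {m : ℕ}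
    (S : Fin m → (Fin D → ℝ) × ℝ) (θ : Params n) : ℝ :=
  (∑ i, Q.lossAt ℓ θ (S i)) / (m : ℝ)

/-- The generalization gap after `T` steps of stochastic gradient descent on `S`, in expectation
over the `T` independent uniformly random choices of a training example. -/
def expectedGap (Q : ReuploadingQNN N L D n) (ℓ : ℝ → ℝ → ℝ) (P : Measure ((Fin D → ℝ) × ℝ))
    (η : ℝ) (T : ℕ) (θ₀ : Params n) {m : ℕ} (S : Fin m → (Fin D → ℝ) × ℝ) : ℝ :=
  (∑ σ : Fin T → Fin m,
    (Q.risk ℓ P (Q.sgdRun ℓ η θ₀ S σ) - Q.empiricalRisk ℓ S (Q.sgdRun ℓ η θ₀ S σ)))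
      / (m : ℝ) ^ T

end ReuploadingQNN

/-- The loss `ℓ (prediction, label)`, for predictions in the interval `I` and labels in `Y`, is
`C₁`-Lipschitz and `C₂`-smooth in the prediction and takes values in `[0, B]`. The choice
`I = Y = Set.univ` requires this for all predictions and all labels. -/
structure LipschitzSmoothBounded (ℓ : ℝ → ℝ → ℝ) (I Y : Set ℝ) (C₁ C₂ : ℝ≥0) (B : ℝ) :
    Prop where
  lipschitz : ∀ y ∈ Y, LipschitzOnWith C₁ (fun a => ℓ a y) I
  differentiable : ∀ y ∈ Y, DifferentiableOn ℝ (fun a => ℓ a y) I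
  smooth : ∀ y ∈ Y, LipschitzOnWith C₂ (derivWithin (fun a => ℓ a y) I) I
  bounded : ∀ y ∈ Y, ∀ a ∈ I, 0 ≤ ℓ a y ∧ ℓ a y ≤ B

end QNN

end

/-!
Under `T` steps of stochastic gradient descent a given one of the `m` examples is visited with
probability at most `T / m`. A run that never visits it is not affected by its replacement, and two
values of the loss at the same point differ by at most `2 C₁ ‖ℳ‖`, because the outputs lie in
`[-‖ℳ‖, ‖ℳ‖]`. Hence the loss averaged over the random indices is uniformly stable with constant
`2 C₁ ‖ℳ‖ T / m`. Uniform stability bounds the expected generalization gap (exchange an example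
with a ghost sample) and gives the gap bounded differences, so that McDiarmid's inequality bounds
its deviation from the expectation. This shows the claim with `g_T(u) = 4 C₁ T`, and `T ≤ u ^ T`
as soon as `u ≥ 2`.
-/

section Subgaussian

open ProbabilityTheory

variable {X Y : Type*} [MeasurableSpace X] [MeasurableSpace Y]

theorem hasSubgaussianMGF_sub_integral_of_abs_sub_le {μ : Measure X} [IsProbabilityMeasure μ]
    {φ : X → ℝ} (hφ : AEMeasurable φ μ) {c : ℝ≥0} (hc : ∀ x x', |φ x - φ x'| ≤ c) :
    HasSubgaussianMGF (fun x => φ x - ∫ x, φ x ∂μ) ((c / 2) ^ 2) μ := by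
  have : Nonempty X := μ.nonempty_of_neZero
  have hle : ∀ x x', φ x ≤ φ x' + c := fun x x' => by linarith [(abs_le.1 (hc x x')).2]
  have hbdd : BddBelow (Set.range φ) := by
    obtain ⟨x₀⟩ := this
    exact ⟨φ x₀ - c, Set.forall_mem_range.2 fun x => by linarith [hle x₀ x]⟩
  have hmem : ∀ x, φ x ∈ Set.Icc (⨅ x, φ x) ((⨅ x, φ x) + c) := fun x =>
    ⟨ciInf_le hbdd x, by linarith [le_ciInf fun x' => sub_le_iff_le_add.2 (hle x x')]⟩
  simpa using hasSubgaussianMGF_of_mem_Icc hφ (.of_forall hmem)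

theorem hasSubgaussianMGF_prod {μ : Measure X} {ν : Measure Y} [SFinite μ] [SFinite ν]
    {Φ : X × Y → ℝ} {Ψ : X → ℝ} {c d : ℝ≥0} (hΦ : AEStronglyMeasurable Φ (μ.prod ν))
    (hΨ : HasSubgaussianMGF Ψ c μ)
    (hsec : ∀ᵐ x ∂μ, HasSubgaussianMGF (fun y => Φ (x, y) - Ψ x) d ν) :
    HasSubgaussianMGF Φ (c + d) (μ.prod ν) := by
  have hfactor : ∀ t x y, Real.exp (t * Φ (x, y))
      = Real.exp (t * Ψ x) * Real.exp (t * (Φ (x, y) - Ψ x)) := fun t x y => by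
    rw [← Real.exp_add]; ring_nf
  have hmeas : ∀ t, AEStronglyMeasurable (fun p => Real.exp (t * Φ p)) (μ.prod ν) := fun t =>
    (hΦ.aemeasurable.const_mul t).exp.aestronglyMeasurable
  have hle : ∀ t, ∀ᵐ x ∂μ, ∫ y, Real.exp (t * Φ (x, y)) ∂ν
      ≤ Real.exp (t * Ψ x) * Real.exp (d * t ^ 2 / 2) := fun t =>
    hsec.mono fun x hx => by
      simp only [hfactor, integral_const_mul]
      gcongr
      exact hx.mgf_le t
  have hbound : ∀ t, Integrable (fun x => Real.exp (t * Ψ x) * Real.exp (d * t ^ 2 / 2)) μ :=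
    fun t => (hΨ.integrable_exp_mul t).mul_const _
  have hint : ∀ t, Integrable (fun p => Real.exp (t * Φ p)) (μ.prod ν) := fun t => by
    refine (integrable_prod_iff (hmeas t)).2 ⟨hsec.mono fun x hx => ?_, ?_⟩
    · simpa only [hfactor] using (hx.integrable_exp_mul t).const_mul _
    · simp only [Real.norm_eq_abs, Real.abs_exp]
      refine (hbound t).mono' (hmeas t).integral_prod_right' ((hle t).mono fun x hx => ?_)
      rwa [Real.norm_of_nonneg (integral_nonneg fun y => (Real.exp_pos _).le)]
  refine ⟨hint, fun t => ?_⟩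
  calc ∫ p, Real.exp (t * Φ p) ∂μ.prod ν
      = ∫ x, ∫ y, Real.exp (t * Φ (x, y)) ∂ν ∂μ := integral_prod _ (hint t)
    _ ≤ ∫ x, Real.exp (t * Ψ x) * Real.exp (d * t ^ 2 / 2) ∂μ :=
        integral_mono_ae (hint t).integral_prod_left (hbound t) (hle t)
    _ = mgf Ψ μ t * Real.exp (d * t ^ 2 / 2) := integral_mul_const _ _
    _ ≤ Real.exp (c * t ^ 2 / 2) * Real.exp (d * t ^ 2 / 2) := by
        gcongr
        exact hΨ.mgf_le t
    _ = Real.exp ((c + d : ℝ≥0) * t ^ 2 / 2) := by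
        rw [← Real.exp_add]; push_cast; ring_nf

theorem measureReal_sqrt_log_lt_le_of_hasSubgaussianMGF {μ : Measure X} {φ : X → ℝ} {c : ℝ≥0}
    [IsFiniteMeasure μ] (hφ : HasSubgaussianMGF φ c μ) {δ : ℝ} (hδ : 0 < δ) (hδ1 : δ ≤ 1) :
    μ.real {x | √(2 * c * Real.log (1 / δ)) < φ x} ≤ δ := by
  have hlog : 0 ≤ Real.log (1 / δ) := Real.log_nonneg (one_le_one_div hδ hδ1)
  rcases eq_or_ne c 0 with rfl | hc
  · have hnull : μ {x | √(2 * (0 : ℝ≥0) * Real.log (1 / δ)) < φ x} = 0 :=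
      measure_mono_null (fun x hx => (by simpa using hx : 0 < φ x).ne')
        hφ.ae_eq_zero_of_hasSubgaussianMGF_zero
    rw [measureReal_def, hnull, ENNReal.toReal_zero]
    exact hδ.le
  calc μ.real {x | √(2 * c * Real.log (1 / δ)) < φ x}
      ≤ μ.real {x | √(2 * c * Real.log (1 / δ)) ≤ φ x} :=
        measureReal_mono fun _ => le_of_lt (α := ℝ)
    _ ≤ Real.exp (-√(2 * c * Real.log (1 / δ)) ^ 2 / (2 * c)) :=
        hφ.measure_ge_le (by positivity)
    _ = δ := by
      have hc' : (2 * c : ℝ) ≠ 0 := by exact_mod_cast mul_ne_zero two_ne_zero hc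
      rw [Real.sq_sqrt (by positivity), neg_div, mul_div_cancel_left₀ _ hc', one_div, Real.log_inv,
        neg_neg, Real.exp_log hδ]

end Subgaussian

section BoundedDifferences

open ProbabilityTheory

theorem measurePreserving_cons {m : ℕ} {Z : Fin (m + 1) → Type*} [∀ i, MeasurableSpace (Z i)]
    (P : ∀ i, Measure (Z i)) [∀ i, SigmaFinite (P i)] :
    MeasurePreserving (fun p : Z 0 × (∀ i : Fin m, Z i.succ) => (Fin.cons p.1 p.2 : ∀ i, Z i))
      ((P 0).prod (Measure.pi fun i : Fin m => P i.succ)) (Measure.pi P) := by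
  have hcons : ⇑(MeasurableEquiv.piFinSuccAbove Z 0).symm = fun p => Fin.cons p.1 p.2 :=
    funext fun p => Fin.insertNth_zero p.1 p.2
  exact hcons ▸ (measurePreserving_piFinSuccAbove P 0).symm

/-- The hypothesis of McDiarmid's inequality: changing the `i`-th argument of `Φ` changes its value
by at most `c i`. -/
def HasBoundedDifferences {ι : Type*} [DecidableEq ι] {Z : ι → Type*} (Φ : (∀ i, Z i) → ℝ)
    (c : ι → ℝ≥0) : Prop :=
  ∀ S i z, |Φ (Function.update S i z) - Φ S| ≤ c i

namespace HasBoundedDifferences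

theorem cons {m : ℕ} {Z : Fin (m + 1) → Type*} {Φ : (∀ i, Z i) → ℝ} {c : Fin (m + 1) → ℝ≥0}
    (h : HasBoundedDifferences Φ c) (z : Z 0) :
    HasBoundedDifferences (fun S : ∀ i : Fin m, Z i.succ => Φ (Fin.cons z S))
      fun i => c i.succ := fun S i w => by
  simpa only [Fin.cons_update] using h (Fin.cons z S) i.succ w

theorem abs_cons_sub_cons_le {m : ℕ} {Z : Fin (m + 1) → Type*} {Φ : (∀ i, Z i) → ℝ}
    {c : Fin (m + 1) → ℝ≥0} (h : HasBoundedDifferences Φ c) (z z' : Z 0)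
    (S : ∀ i : Fin m, Z i.succ) : |Φ (Fin.cons z S) - Φ (Fin.cons z' S)| ≤ c 0 := by
  simpa only [Fin.update_cons_zero] using h (Fin.cons z' S) 0 z

theorem abs_sub_le {m : ℕ} {Z : Fin m → Type*} {Φ : (∀ i, Z i) → ℝ} {c : Fin m → ℝ≥0}
    (h : HasBoundedDifferences Φ c) (S S' : ∀ i, Z i) : |Φ S - Φ S'| ≤ ∑ i, c i := by
  induction m with
  | zero => simp [Subsingleton.elim S S']
  | succ m ih =>
    induction S using Fin.consCases with | _ z S => ?_
    induction S' using Fin.consCases with | _ z' S' => ?_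
    calc |Φ (Fin.cons z S) - Φ (Fin.cons z' S')|
        ≤ |Φ (Fin.cons z S) - Φ (Fin.cons z' S)|
          + |Φ (Fin.cons z' S) - Φ (Fin.cons z' S')| := _root_.abs_sub_le _ _ _
      _ ≤ c 0 + ∑ i : Fin m, c i.succ :=
        add_le_add (h.abs_cons_sub_cons_le z z' S) (by exact_mod_cast ih (h.cons z') S S')
      _ = ∑ i, c i := by push_cast [Fin.sum_univ_succ]; rfl

theorem integrable {m : ℕ} {Z : Fin m → Type*} [∀ i, MeasurableSpace (Z i)]
    {Φ : (∀ i, Z i) → ℝ} {c : Fin m → ℝ≥0} (h : HasBoundedDifferences Φ c) (hΦ : Measurable Φ)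
    (μ : Measure (∀ i, Z i)) [IsFiniteMeasure μ] : Integrable Φ μ := by
  rcases isEmpty_or_nonempty (∀ i, Z i) with _ | ⟨⟨S₀⟩⟩
  · exact Integrable.of_isEmpty
  refine .of_bound hΦ.aestronglyMeasurable (∑ i, c i + |Φ S₀|) (.of_forall fun S => ?_)
  exact (norm_le_norm_sub_add (Φ S) (Φ S₀)).trans (add_le_add (h.abs_sub_le S S₀) le_rfl)

/-- **McDiarmid's inequality** in sub-Gaussian form. -/
theorem hasSubgaussianMGF {m : ℕ} {Z : Fin m → Type*} [∀ i, MeasurableSpace (Z i)]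
    {P : ∀ i, Measure (Z i)} [∀ i, IsProbabilityMeasure (P i)] {Φ : (∀ i, Z i) → ℝ}
    {c : Fin m → ℝ≥0} (h : HasBoundedDifferences Φ c) (hΦ : Measurable Φ) :
    HasSubgaussianMGF (fun S => Φ S - ∫ S, Φ S ∂Measure.pi P) (∑ i, (c i / 2) ^ 2)
      (Measure.pi P) := by
  induction m with
  | zero =>
    have hconst : ∀ S, Φ S = Φ default := fun S => congrArg Φ (Subsingleton.elim S default)
    simp [hconst]
  | succ m ih =>
    let μ := Measure.pi fun i : Fin m => P i.succ
    have hcons := measurePreserving_cons P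
    have hΦ' : Measurable fun p : Z 0 × (∀ i : Fin m, Z i.succ) => Φ (Fin.cons p.1 p.2) :=
      hΦ.comp hcons.measurable
    have hΦz : ∀ z, Measurable fun S : ∀ i : Fin m, Z i.succ => Φ (Fin.cons z S) := fun z =>
      hΦ'.comp measurable_prodMk_left
    let Ψ : Z 0 → ℝ := fun z => ∫ S, Φ (Fin.cons z S) ∂μ
    have hΨ : Measurable Ψ := hΦ'.stronglyMeasurable.integral_prod_right'.measurable
    have hΨc : ∀ z z', |Ψ z - Ψ z'| ≤ c 0 := fun z z' => by
      rw [← integral_sub ((h.cons z).integrable (hΦz z) μ) ((h.cons z').integrable (hΦz z') μ)]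
      simpa [Ψ] using norm_integral_le_of_norm_le_const (μ := μ) (C := c 0)
        (f := fun S => Φ (Fin.cons z S) - Φ (Fin.cons z' S))
        (.of_forall fun S => h.abs_cons_sub_cons_le z z' S)
    have hmean : ∫ z, Ψ z ∂P 0 = ∫ S, Φ S ∂Measure.pi P := by
      rw [← hcons.map_eq, integral_map hcons.aemeasurable hΦ.aestronglyMeasurable,
        integral_prod (fun p => Φ (Fin.cons p.1 p.2))
          (hcons.integrable_comp_of_integrable (h.integrable hΦ _))]
    have hprod := hasSubgaussianMGF_prod
      (hΦ'.sub_const (∫ S, Φ S ∂Measure.pi P)).aestronglyMeasurable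
      (hmean ▸ hasSubgaussianMGF_sub_integral_of_abs_sub_le hΨ.aemeasurable hΨc)
      (.of_forall fun z => by simpa only [sub_sub_sub_cancel_right] using ih (h.cons z) (hΦz z))
    rw [Fin.sum_univ_succ]
    refine hprod.congr_identDistrib ⟨(hΦ'.sub_const _).aemeasurable,
      (hΦ.sub_const _).aemeasurable, ?_⟩
    exact (Measure.map_map (hΦ.sub_const _) hcons.measurable).symm.trans (by rw [hcons.map_eq])

end HasBoundedDifferences

end BoundedDifferences

section Resampling

variable {ι : Type*} [Fintype ι] [DecidableEq ι] {Z : ι → Type*} [∀ i, MeasurableSpace (Z i)]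

theorem measurePreserving_update (P : ∀ i, Measure (Z i)) [∀ i, IsProbabilityMeasure (P i)]
    (i : ι) :
    MeasurePreserving (fun p : (∀ i, Z i) × Z i => Function.update p.1 i p.2)
      ((Measure.pi P).prod (P i)) (Measure.pi P) := by
  refine ⟨measurable_update', (Measure.pi_eq fun s hs => ?_).symm⟩
  have hpre : (fun p : (∀ i, Z i) × Z i => Function.update p.1 i p.2) ⁻¹' Set.univ.pi s
      = Set.univ.pi (Function.update s i Set.univ) ×ˢ s i := by
    ext p
    simp only [Set.mem_preimage, Set.mem_univ_pi, Set.mem_prod]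
    rw [Function.forall_update_iff p.1 fun j x => x ∈ s j,
      Function.forall_update_iff s fun j t => p.1 j ∈ t]
    simp [and_comm]
  rw [Measure.map_apply measurable_update' (MeasurableSet.univ_pi hs), hpre, Measure.prod_prod,
    Measure.pi_pi, ← Finset.prod_erase_mul _ _ (Finset.mem_univ i),
    ← Finset.prod_erase_mul _ _ (Finset.mem_univ i), Function.update_self, measure_univ, mul_one]
  congr 1
  exact Finset.prod_congr rfl fun j hj => by rw [Function.update_of_ne (Finset.ne_of_mem_erase hj)]

end Resampling

section Stability

variable {Z : Type*} {m : ℕ} {V : (Fin m → Z) → Z → ℝ} {β M : ℝ≥0}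

/-- Uniform stability in the sense of Bousquet and Elisseeff: replacing one training example
changes the loss `V S z` of the hypothesis learned from the sample `S` at any `z` by at most `β`. -/
def UniformlyStable (V : (Fin m → Z) → Z → ℝ) (β : ℝ≥0) : Prop :=
  ∀ z, HasBoundedDifferences (fun S => V S z) fun _ => β

/-- The risk minus the empirical risk of the hypothesis learned from `S`, whose loss at `z` is
`V S z`. -/
noncomputable def generalizationGap [MeasurableSpace Z] (P : Measure Z)
    (V : (Fin m → Z) → Z → ℝ) (S : Fin m → Z) : ℝ :=
  ∫ z, V S z ∂P - (∑ k, V S (S k)) / m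

theorem UniformlyStable.abs_empirical_update_sub_le (h : UniformlyStable V β)
    (hM : ∀ S z, V S z ∈ Set.Icc 0 (M : ℝ)) (S : Fin m → Z) (i : Fin m) (w : Z) :
    |(∑ k, V (Function.update S i w) (Function.update S i w k)) / m - (∑ k, V S (S k)) / m|
      ≤ β + M / m := by
  have hm : (0 : ℝ) < m := by exact_mod_cast i.pos
  have hterm : ∀ k, |V (Function.update S i w) (Function.update S i w k) - V S (S k)|
      ≤ β + if k = i then (M : ℝ) else 0 := fun k => by
    split_ifs with hk
    · exact (abs_sub_le_of_nonneg_of_le (hM _ _).1 (hM _ _).2 (hM _ _).1 (hM _ _).2).trans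
        (le_add_of_nonneg_left β.2)
    · simpa only [Function.update_of_ne hk, add_zero] using h (S k) S i w
  rw [← sub_div, ← Finset.sum_sub_distrib, abs_div, abs_of_pos hm, div_le_iff₀ hm]
  calc |∑ k, (V (Function.update S i w) (Function.update S i w k) - V S (S k))|
      ≤ ∑ k, (β + if k = i then (M : ℝ) else 0) :=
        (Finset.abs_sum_le_sum_abs _ _).trans (Finset.sum_le_sum fun k _ => hterm k)
    _ = (β + M / m) * m := by simp [Finset.sum_add_distrib]; field_simp

variable [MeasurableSpace Z] {P : Measure Z}

theorem measurable_generalizationGap [SFinite P] (hV : Measurable (Function.uncurry V)) :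
    Measurable (generalizationGap P V) := by
  refine hV.stronglyMeasurable.integral_prod_right'.measurable.sub (.div_const ?_ _)
  exact Finset.measurable_sum _ fun k _ => hV.comp (measurable_id.prodMk (measurable_pi_apply k))

namespace UniformlyStable

variable [IsProbabilityMeasure P]

theorem abs_integral_update_sub_le (h : UniformlyStable V β) (hi : ∀ S, Integrable (V S) P)
    (S : Fin m → Z) (i : Fin m) (w : Z) :
    |∫ z, V (Function.update S i w) z ∂P - ∫ z, V S z ∂P| ≤ β := by
  rw [← integral_sub (hi _) (hi _)]
  simpa using norm_integral_le_of_norm_le_const (μ := P) (C := β)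
    (f := fun z => V (Function.update S i w) z - V S z) (.of_forall fun z => h z S i w)

theorem hasBoundedDifferences_generalizationGap (h : UniformlyStable V β)
    (hi : ∀ S, Integrable (V S) P) (hM : ∀ S z, V S z ∈ Set.Icc 0 (M : ℝ)) :
    HasBoundedDifferences (generalizationGap P V) fun _ => 2 * β + M / m := fun S i w => by
  rw [generalizationGap, generalizationGap, sub_sub_sub_comm]
  refine (abs_sub _ _).trans ((add_le_add (h.abs_integral_update_sub_le hi S i w)
    (h.abs_empirical_update_sub_le hM S i w)).trans_eq ?_)
  push_cast
  ring

/-- The ghost sample argument: after resampling the `k`-th example, the loss at the new example has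
the law of the loss at a training example. -/
theorem integral_sub_integral_le (h : UniformlyStable V β)
    (hV : Measurable (Function.uncurry V)) (hM : ∀ S z, V S z ∈ Set.Icc 0 (M : ℝ)) (k : Fin m) :
    ∫ S, ∫ z, V S z ∂P ∂(Measure.pi fun _ => P) - ∫ S, V S (S k) ∂(Measure.pi fun _ => P)
      ≤ β := by
  let μ := Measure.pi fun _ : Fin m => P
  have hresample : MeasurePreserving (fun p : (Fin m → Z) × Z => Function.update p.1 k p.2)
      (μ.prod P) μ := measurePreserving_update (fun _ => P) k
  have hdiag : Measurable fun S : Fin m → Z => V S (S k) :=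
    hV.comp (measurable_id.prodMk (measurable_pi_apply k))
  have hint : Integrable (fun p : (Fin m → Z) × Z => V p.1 p.2) (μ.prod P) :=
    .of_mem_Icc 0 M hV.aemeasurable (.of_forall fun p => hM p.1 p.2)
  have hint' : Integrable (fun p => V (Function.update p.1 k p.2) p.2) (μ.prod P) :=
    .of_mem_Icc 0 M (hV.comp (hresample.measurable.prodMk measurable_snd)).aemeasurable
      (.of_forall fun p => hM _ p.2)
  have hghost : ∫ S, V S (S k) ∂μ = ∫ p, V (Function.update p.1 k p.2) p.2 ∂μ.prod P := by
    conv_lhs => rw [← hresample.map_eq]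
    simp [integral_map hresample.aemeasurable hdiag.aestronglyMeasurable]
  calc ∫ S, ∫ z, V S z ∂P ∂μ - ∫ S, V S (S k) ∂μ
      = ∫ p, (V p.1 p.2 - V (Function.update p.1 k p.2) p.2) ∂μ.prod P := by
        rw [hghost, integral_integral hint, integral_sub hint hint']
    _ ≤ ∫ _, (β : ℝ) ∂μ.prod P := integral_mono (hint.sub hint') (integrable_const _) fun p => by
        have := neg_le_of_abs_le (h p.2 p.1 k p.2)
        linarith
    _ = β := by simp

theorem integral_generalizationGap_le (h : UniformlyStable V β) (hm : m ≠ 0)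
    (hV : Measurable (Function.uncurry V)) (hM : ∀ S z, V S z ∈ Set.Icc 0 (M : ℝ)) :
    ∫ S, generalizationGap P V S ∂(Measure.pi fun _ => P) ≤ β := by
  let μ := Measure.pi fun _ : Fin m => P
  have hm' : (0 : ℝ) < m := by exact_mod_cast hm.bot_lt
  have hrisk : Integrable (fun S => ∫ z, V S z ∂P) μ :=
    (Integrable.of_mem_Icc 0 M hV.aemeasurable (.of_forall fun p => hM p.1 p.2) :
      Integrable (Function.uncurry V) (μ.prod P)).integral_prod_left
  have hemp : ∀ k, Integrable (fun S => V S (S k)) μ := fun k =>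
    .of_mem_Icc 0 M (hV.comp (measurable_id.prodMk (measurable_pi_apply k))).aemeasurable
      (.of_forall fun S => hM S _)
  calc ∫ S, generalizationGap P V S ∂μ
      = (∑ k, (∫ S, ∫ z, V S z ∂P ∂μ - ∫ S, V S (S k) ∂μ)) / m := by
        simp only [generalizationGap]
        rw [integral_sub hrisk ((integrable_finsetSum _ fun k _ => hemp k).div_const _),
          integral_div, integral_finsetSum _ fun k _ => hemp k, Finset.sum_sub_distrib]
        simp [sub_div, hm'.ne']
    _ ≤ (∑ _ : Fin m, (β : ℝ)) / m := by
        gcongr with k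
        exact h.integral_sub_integral_le hV hM k
    _ = β := by simp [hm'.ne']

theorem ofReal_one_sub_le_measure_generalizationGap_le (h : UniformlyStable V β) (hm : m ≠ 0)
    (hV : Measurable (Function.uncurry V)) (hM : ∀ S z, V S z ∈ Set.Icc 0 (M : ℝ)) {δ : ℝ}
    (hδ : 0 < δ) (hδ1 : δ ≤ 1) :
    ENNReal.ofReal (1 - δ) ≤ (Measure.pi fun _ => P)
      {S | generalizationGap P V S
        ≤ β + (2 * m * β + M) * √(Real.log (1 / δ) / (2 * m))} := by
  let μ := Measure.pi fun _ : Fin m => P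
  have hgap : Measurable (generalizationGap P V) := measurable_generalizationGap hV
  have hi : ∀ S, Integrable (V S) P := fun S =>
    .of_mem_Icc 0 M (hV.comp measurable_prodMk_left).aemeasurable (.of_forall (hM S))
  have hsub := (h.hasBoundedDifferences_generalizationGap hi hM).hasSubgaussianMGF
    (P := fun _ => P) hgap
  have hscale : √(2 * ↑(∑ _ : Fin m, ((2 * β + M / m) / 2) ^ 2 : ℝ≥0) * Real.log (1 / δ))
      = (2 * m * β + M) * √(Real.log (1 / δ) / (2 * m)) := by
    rw [← Real.sqrt_sq (by positivity : 0 ≤ 2 * m * (β : ℝ) + M), ← Real.sqrt_mul (by positivity)]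
    congr 1
    push_cast [Finset.sum_const, Finset.card_univ, Fintype.card_fin, nsmul_eq_mul]
    have hm' : (m : ℝ) ≠ 0 := by exact_mod_cast hm
    field_simp
  set ε := (2 * m * β + M) * √(Real.log (1 / δ) / (2 * m))
  have hbad : μ.real {S | generalizationGap P V S ≤ β + ε}ᶜ ≤ δ := by
    refine (measureReal_mono fun S hS => ?_).trans
      (measureReal_sqrt_log_lt_le_of_hasSubgaussianMGF hsub hδ hδ1)
    simp only [hscale, Set.mem_compl_iff, Set.mem_ofPred_eq, not_le] at hS ⊢
    linarith [h.integral_generalizationGap_le (P := P) hm hV hM]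
  have hmeas : MeasurableSet {S | generalizationGap P V S ≤ β + ε} :=
    measurableSet_le hgap measurable_const
  rw [← ofReal_measureReal]
  exact ENNReal.ofReal_le_ofReal (by linarith [probReal_add_probReal_compl (μ := μ) hmeas, hbad])

end UniformlyStable

end Stability

section SampledIteration

open Finset in
theorem card_filter_exists_apply_eq_mul_le {κ ι : Type*} [Fintype κ] [DecidableEq κ] [Fintype ι]
    (i : ι) [DecidablePred fun σ : κ → ι => ∃ t, σ t = i] :
    #{σ : κ → ι | ∃ t, σ t = i} * Fintype.card ι ≤
      Fintype.card κ * Fintype.card ι ^ Fintype.card κ := by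
  classical
  have hfiber : ∀ t : κ, #{σ : κ → ι | σ t = i} = Fintype.card ι ^ (Fintype.card κ - 1) :=
    fun t => by
      simpa using Fintype.card_filter_piFinset_const_eq_of_mem (univ : Finset ι) t (mem_univ i)
  calc #{σ : κ → ι | ∃ t, σ t = i} * Fintype.card ι
      = #(univ.biUnion fun t => {σ : κ → ι | σ t = i}) * Fintype.card ι := by
        congr 2; ext σ; simp
    _ ≤ (∑ t : κ, #{σ : κ → ι | σ t = i}) * Fintype.card ι := by gcongr; exact card_biUnion_le
    _ = ∑ _ : κ, Fintype.card ι ^ Fintype.card κ := by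
        rw [sum_mul]
        refine sum_congr rfl fun t _ => ?_
        rw [hfiber, pow_sub_one_mul (Fintype.card_pos_iff.2 ⟨t⟩).ne']
    _ = Fintype.card κ * Fintype.card ι ^ Fintype.card κ := by simp

variable {Θ Z : Type*} {F F' : Θ → Z → ℝ} {G G' : Θ → Z → Θ} {θ₀ : Θ} {m T : ℕ} {B M : ℝ≥0}

/-- The parameters learned by `T` steps of the update rule `G` started at `θ₀`, when the `t`-th step
uses the training example number `σ t`. -/
def sampledIterate {ι : Type*} (G : Θ → Z → Θ) (θ₀ : Θ) (S : ι → Z) (σ : Fin T → ι) : Θ :=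
  (List.ofFn σ).foldl (fun θ i => G θ (S i)) θ₀

theorem sampledIterate_congr {ι : Type*} {S S' : ι → Z} {σ : Fin T → ι}
    (h : ∀ t θ, G θ (S (σ t)) = G' θ (S' (σ t))) :
    sampledIterate G θ₀ S σ = sampledIterate G' θ₀ S' σ := by
  refine List.foldl_ext _ _ _ fun θ i hi => ?_
  obtain ⟨t, rfl⟩ := (List.mem_ofFn' _ _).1 hi
  exact h t θ

/-- The loss `F` at `z` of the parameters learned from the sample `S`, in expectation over
independent uniformly random choices of a training example in each of the `T` steps. -/
noncomputable def meanLoss (F : Θ → Z → ℝ) (G : Θ → Z → Θ) (θ₀ : Θ) (T : ℕ) (S : Fin m → Z)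
    (z : Z) : ℝ :=
  (∑ σ : Fin T → Fin m, F (sampledIterate G θ₀ S σ) z) / m ^ T

theorem meanLoss_mem_Icc (hm : m ≠ 0) (hM : ∀ θ z, F θ z ∈ Set.Icc 0 (M : ℝ)) (S : Fin m → Z)
    (z : Z) : meanLoss F G θ₀ T S z ∈ Set.Icc 0 (M : ℝ) := by
  refine ⟨div_nonneg (Finset.sum_nonneg fun σ _ => (hM _ z).1) (by positivity), ?_⟩
  rw [meanLoss, div_le_iff₀ (by positivity)]
  calc ∑ σ : Fin T → Fin m, F (sampledIterate G θ₀ S σ) z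
      ≤ ∑ _ : Fin T → Fin m, (M : ℝ) := Finset.sum_le_sum fun σ _ => (hM _ z).2
    _ = M * m ^ T := by simp [mul_comm]

/-- The training can notice the replacement of the `i`-th example only if it visits that example,
which happens with probability at most `T / m`. -/
theorem uniformlyStable_meanLoss (hB : ∀ θ θ' z, |F θ z - F θ' z| ≤ B) :
    UniformlyStable (m := m) (meanLoss F G θ₀ T) (T * B / m) := fun z S i w => by
  have hm : (0 : ℝ) < m := by exact_mod_cast i.pos
  have hterm : ∀ σ : Fin T → Fin m,
      |F (sampledIterate G θ₀ (Function.update S i w) σ) z - F (sampledIterate G θ₀ S σ) z|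
        ≤ if ∃ t, σ t = i then (B : ℝ) else 0 := fun σ => by
    split_ifs with hvisit
    · exact hB _ _ z
    · rw [sampledIterate_congr (S' := S) (G' := G) fun t θ => by
        rw [Function.update_of_ne (not_exists.1 hvisit t)], sub_self, abs_zero]
  have hcard : (Finset.card {σ : Fin T → Fin m | ∃ t, σ t = i} * m : ℝ) ≤ T * m ^ T := by
    exact_mod_cast Fintype.card_fin m ▸ Fintype.card_fin T ▸
      card_filter_exists_apply_eq_mul_le (κ := Fin T) i
  simp only [meanLoss]
  rw [← sub_div, ← Finset.sum_sub_distrib, abs_div, abs_of_pos (pow_pos hm T),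
    div_le_iff₀ (pow_pos hm T)]
  calc |∑ σ : Fin T → Fin m, (F (sampledIterate G θ₀ (Function.update S i w) σ) z
        - F (sampledIterate G θ₀ S σ) z)|
      ≤ ∑ σ : Fin T → Fin m, if ∃ t, σ t = i then (B : ℝ) else 0 :=
        (Finset.abs_sum_le_sum_abs _ _).trans (Finset.sum_le_sum fun σ _ => hterm σ)
    _ = Finset.card {σ : Fin T → Fin m | ∃ t, σ t = i} * m * (B / m) := by
        rw [← Finset.sum_filter, Finset.sum_const, nsmul_eq_mul]; field_simp
    _ ≤ T * m ^ T * (B / m) := by gcongr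
    _ = (T * B / m : ℝ≥0) * m ^ T := by push_cast; ring

variable [MeasurableSpace Z] {P : Measure Z}

theorem generalizationGap_meanLoss_ae_congr [IsProbabilityMeasure P]
    (hF : ∀ᵐ z ∂P, ∀ θ, F θ z = F' θ z) (hG : ∀ᵐ z ∂P, ∀ θ, G θ z = G' θ z) :
    generalizationGap P (meanLoss F G θ₀ T) =ᵐ[Measure.pi fun _ : Fin m => P]
      generalizationGap P (meanLoss F' G' θ₀ T) := by
  have hS : ∀ᵐ S ∂(Measure.pi fun _ : Fin m => P),
      ∀ i, (∀ θ, F θ (S i) = F' θ (S i)) ∧ ∀ θ, G θ (S i) = G' θ (S i) :=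
    ae_all_iff.2 fun i => (Measure.quasiMeasurePreserving_eval (fun _ => P) i).ae (hF.and hG)
  filter_upwards [hS] with S hS
  have hrun : ∀ σ : Fin T → Fin m, sampledIterate G θ₀ S σ = sampledIterate G' θ₀ S σ := fun σ =>
    sampledIterate_congr fun t θ => (hS (σ t)).2 θ
  have hloss : ∀ z, (∀ θ, F θ z = F' θ z) →
      meanLoss F G θ₀ T S z = meanLoss F' G' θ₀ T S z := fun z hz => by
    simp only [meanLoss, hrun, hz]
  rw [generalizationGap, generalizationGap, integral_congr_ae (hF.mono hloss),
    Finset.sum_congr rfl fun k _ => hloss (S k) (hS k).1]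

variable [MeasurableSpace Θ]

theorem measurable_sampledIterate {ι : Type*} (hG : Measurable (Function.uncurry G))
    (σ : Fin T → ι) : Measurable fun S : ι → Z => sampledIterate G θ₀ S σ := by
  suffices hfoldl : ∀ (l : List ι) {θ : (ι → Z) → Θ}, Measurable θ →
      Measurable fun S => l.foldl (fun θ i => G θ (S i)) (θ S) from hfoldl _ measurable_const
  refine List.rec (fun hθ => hθ) fun i _ ih _ hθ => ?_
  exact ih (hG.comp (hθ.prodMk (measurable_pi_apply i)))

theorem measurable_uncurry_meanLoss (hF : Measurable (Function.uncurry F))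
    (hG : Measurable (Function.uncurry G)) :
    Measurable (Function.uncurry (meanLoss (m := m) F G θ₀ T)) :=
  .div_const (Finset.measurable_sum _ fun σ _ => hF.comp
    (((measurable_sampledIterate hG σ).comp measurable_fst).prodMk measurable_snd)) _

theorem ofReal_one_sub_le_measure_generalizationGap_meanLoss_le [IsProbabilityMeasure P]
    (hF : Measurable (Function.uncurry F)) (hG : Measurable (Function.uncurry G))
    (hM : ∀ θ z, F θ z ∈ Set.Icc 0 (M : ℝ)) (hB : ∀ θ θ' z, |F θ z - F θ' z| ≤ B)
    (hm : m ≠ 0) {δ : ℝ} (hδ : 0 < δ) (hδ1 : δ ≤ 1) :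
    ENNReal.ofReal (1 - δ) ≤ (Measure.pi fun _ : Fin m => P)
      {S | generalizationGap P (meanLoss F G θ₀ T) S
        ≤ T * B / m + (2 * T * B + M) * √(Real.log (1 / δ) / (2 * m))} := by
  have h := (uniformlyStable_meanLoss (m := m) (G := G) (θ₀ := θ₀) (T := T)
    hB).ofReal_one_sub_le_measure_generalizationGap_le (P := P) hm
    (measurable_uncurry_meanLoss hF hG) (meanLoss_mem_Icc hm hM) hδ hδ1
  have hm' : (m : ℝ) ≠ 0 := by exact_mod_cast hm
  push_cast at h
  rwa [show 2 * m * (T * B / m : ℝ) = 2 * T * B by field_simp] at h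

end SampledIteration

section GradientDescent

theorem measurable_deriv_of_measurable_uncurry {X : Type*} [MeasurableSpace X] {f : X → ℝ → ℝ}
    (hf : Measurable (Function.uncurry f)) {g : X → ℝ} (hg : Measurable g)
    (hd : ∀ x, DifferentiableAt ℝ (f x) (g x)) : Measurable fun x => deriv (f x) (g x) := by
  let h : ℕ → ℝ := fun k => 1 / (k + 1)
  have hh : Tendsto h atTop (nhdsWithin 0 {0}ᶜ) :=
    tendsto_nhdsWithin_iff.2 ⟨tendsto_one_div_add_atTop_nhds_zero_nat,
      .of_forall fun k => (Nat.one_div_pos_of_nat (n := k)).ne'⟩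
  have hmeas : ∀ {u : X → ℝ}, Measurable u → Measurable fun x => f x (u x) := fun hu =>
    hf.comp (measurable_id.prodMk hu)
  exact measurable_of_tendsto_metrizable
    (fun k => ((hmeas (hg.add_const (h k))).sub (hmeas hg)).const_smul (h k)⁻¹)
    (tendsto_pi_nhds.2 fun x => (hd x).hasDerivAt.tendsto_slope_zero.comp hh)

variable {J Z : Type*} [DecidableEq J] {F : (J → ℝ) → Z → ℝ} {η : ℝ}

/-- One step of gradient descent with learning rate `η` for the loss `F` at the example `z`. -/
noncomputable def gradientStep (η : ℝ) (F : (J → ℝ) → Z → ℝ) (θ : J → ℝ) (z : Z) : J → ℝ :=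
  fun j => θ j - η * deriv (fun s => F (Function.update θ j s) z) (θ j)

variable [MeasurableSpace Z]

theorem measurable_gradientStep (hF : Measurable (Function.uncurry F))
    (hd : ∀ θ z j, DifferentiableAt ℝ (fun s => F (Function.update θ j s) z) (θ j)) :
    Measurable (Function.uncurry (gradientStep η F)) := by
  refine measurable_pi_lambda _ fun j => ?_
  have hj : Measurable fun p : (J → ℝ) × Z => p.1 j := (measurable_pi_apply j).comp measurable_fst
  have hupdate : Measurable fun q : ((J → ℝ) × Z) × ℝ => Function.update q.1.1 j q.2 :=
    measurable_update'.comp (measurable_fst.fst.prodMk measurable_snd)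
  have hderiv := measurable_deriv_of_measurable_uncurry
    (f := fun (p : (J → ℝ) × Z) s => F (Function.update p.1 j s) p.2)
    (hF.comp (hupdate.prodMk measurable_fst.snd)) hj fun p => hd p.1 p.2 j
  exact hj.sub (hderiv.const_mul η)

theorem ofReal_one_sub_le_measure_generalizationGap_gradientStep_le {B M : ℝ≥0} {P : Measure Z}
    [IsProbabilityMeasure P] (hF : Measurable (Function.uncurry F))
    (hd : ∀ᵐ z ∂P, ∀ θ j, DifferentiableAt ℝ (fun s => F (Function.update θ j s) z) (θ j))
    (hM : ∀ᵐ z ∂P, ∀ θ, F θ z ∈ Set.Icc 0 (M : ℝ))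
    (hB : ∀ᵐ z ∂P, ∀ θ θ', |F θ z - F θ' z| ≤ B) (θ₀ : J → ℝ) (T : ℕ) {m : ℕ} (hm : m ≠ 0)
    {δ : ℝ} (hδ : 0 < δ) (hδ1 : δ ≤ 1) :
    ENNReal.ofReal (1 - δ) ≤ (Measure.pi fun _ : Fin m => P)
      {S | generalizationGap P (meanLoss F (gradientStep η F) θ₀ T) S
        ≤ T * B / m + (2 * T * B + M) * √(Real.log (1 / δ) / (2 * m))} := by
  obtain ⟨t, ht, ht_meas, hreg⟩ := (hd.and (hM.and hB)).exists_measurable_mem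
  let F' : (J → ℝ) → Z → ℝ := fun θ => t.indicator (F θ)
  have hF'_mem : ∀ {z}, z ∈ t → ∀ θ, F' θ z = F θ z := fun hz _ => Set.indicator_of_mem hz _
  have hF'_notMem : ∀ {z}, z ∉ t → ∀ θ, F' θ z = 0 := fun hz _ => Set.indicator_of_notMem hz _
  have hF'_meas : Measurable (Function.uncurry F') := hF.indicator (measurable_snd ht_meas)
  have hG'_meas : Measurable (Function.uncurry (gradientStep η F')) :=
    measurable_gradientStep hF'_meas fun θ z j => by
      by_cases hz : z ∈ t
      · simpa only [hF'_mem hz] using (hreg z hz).1 θ j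
      · simp only [hF'_notMem hz, differentiableAt_const]
  have hM' : ∀ θ z, F' θ z ∈ Set.Icc 0 (M : ℝ) := fun θ z => by
    by_cases hz : z ∈ t
    · simpa only [hF'_mem hz] using (hreg z hz).2.1 θ
    · simp [hF'_notMem hz]
  have hB' : ∀ θ θ' z, |F' θ z - F' θ' z| ≤ B := fun θ θ' z => by
    by_cases hz : z ∈ t
    · simpa only [hF'_mem hz] using (hreg z hz).2.2 θ θ'
    · simp [hF'_notMem hz]
  have hFF' : ∀ᵐ z ∂P, ∀ θ, F θ z = F' θ z :=
    mem_of_superset ht fun z hz θ => (hF'_mem hz θ).symm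
  have hGG' : ∀ᵐ z ∂P, ∀ θ, gradientStep η F θ z = gradientStep η F' θ z :=
    hFF'.mono fun z hz θ => funext fun j => by simp only [gradientStep, hz]
  refine (ofReal_one_sub_le_measure_generalizationGap_meanLoss_le (θ₀ := θ₀) (T := T) hF'_meas
    hG'_meas hM' hB' hm hδ hδ1).trans (measure_mono_ae ?_)
  filter_upwards [generalizationGap_meanLoss_ae_congr hFF' hGG'] with S hS hle
  exact hS.trans_le hle

end GradientDescent

section Entrywise

variable {R X n : Type*} [CommRing R] [StarRing R] [Fintype n] [DecidableEq n]

/-- The `*`-algebra of the matrix-valued functions all of whose entries lie in the `*`-algebra `A`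
of scalar functions. It serves to show that the entries of a circuit are as regular as the entries
of its gates, for measurability and differentiability alike. -/
def entrywise (A : StarSubalgebra R (X → R)) : StarSubalgebra R (X → Matrix n n R) where
  carrier := {F | ∀ a b, (fun p => F p a b) ∈ A}
  mul_mem' := fun {F G} hF hG a b => by
    have hentry : (fun p => (F * G) p a b) = ∑ c, (fun p => F p a c) * fun p => G p c b := by
      ext p; simp [Matrix.mul_apply]
    exact hentry ▸ sum_mem fun c _ => mul_mem (hF a c) (hG c b)
  add_mem' := fun hF hG a b => add_mem (hF a b) (hG a b)
  algebraMap_mem' := fun r a b => A.algebraMap_mem (algebraMap R (Matrix n n R) r a b)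
  star_mem' := fun hF a b => star_mem (hF b a)

variable {A : StarSubalgebra R (X → R)}

theorem const_mem_entrywise (M : Matrix n n R) : (fun _ => M) ∈ entrywise A := fun a b =>
  A.algebraMap_mem (M a b)

theorem trace_mem_of_mem_entrywise {F : X → Matrix n n R} (hF : F ∈ entrywise A) :
    (fun p => (F p).trace) ∈ A := by
  have htrace : (fun p => (F p).trace) = ∑ a, fun p => F p a a := by ext p; simp [Matrix.trace]
  exact htrace ▸ sum_mem fun a _ => hF a a

theorem list_prod_map_mem_entrywise {ι : Type*} (l : List ι) {F : ι → X → Matrix n n R}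
    (hF : ∀ i, F i ∈ entrywise A) : (fun p => (l.map fun i => F i p).prod) ∈ entrywise A := by
  have hprod : (fun p => (l.map fun i => F i p).prod) = (l.map F).prod := by
    ext1 p
    rw [Pi.list_prod_apply, List.map_map, Function.comp_def]
  exact hprod ▸ list_prod_mem fun G hG => by
    obtain ⟨i, -, rfl⟩ := List.mem_map.1 hG
    exact hF i

/-- The `*`-algebra of measurable complex functions. -/
def measurableFunctions (X : Type*) [MeasurableSpace X] : StarSubalgebra ℂ (X → ℂ) where
  carrier := {f | Measurable f}
  mul_mem' := Measurable.mul
  add_mem' := Measurable.add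
  algebraMap_mem' := fun _ => measurable_const
  star_mem' := Complex.continuous_conj.measurable.comp

/-- The `*`-algebra of differentiable complex functions of a real variable. -/
def differentiableFunctions : StarSubalgebra ℂ (ℝ → ℂ) where
  carrier := {f | Differentiable ℝ f}
  mul_mem' := Differentiable.mul
  add_mem' := Differentiable.add
  algebraMap_mem' := fun _ => differentiable_const _
  star_mem' := Complex.conjCLE.differentiable.comp

end Entrywise

section TraceDuality

variable {n : Type*} [Fintype n]

open scoped MatrixOrder Matrix.Norms.L2Operator in
theorem exists_eq_conjTranspose_mul_self_of_posSemidef {R : Matrix n n ℂ} (hR : R.PosSemidef) :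
    ∃ C : Matrix n n ℂ, R = C.conjTranspose * C := by
  classical exact CStarAlgebra.nonneg_iff_eq_star_mul_self.1 hR.nonneg

variable [DecidableEq n]

theorem norm_star_dotProduct_mulVec_le (A : Matrix n n ℂ) (v : n → ℂ) :
    ‖star v ⬝ᵥ A.mulVec v‖
      ≤ ‖Matrix.toEuclideanCLM (n := n) (𝕜 := ℂ) A‖ * ∑ a, ‖v a‖ ^ 2 := by
  let w : EuclideanSpace ℂ n := WithLp.toLp 2 v
  have hinner : star v ⬝ᵥ A.mulVec v = inner ℂ w (Matrix.toEuclideanCLM (n := n) (𝕜 := ℂ) A w) := by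
    rw [Matrix.toEuclideanCLM_toLp, EuclideanSpace.inner_toLp_toLp, dotProduct_comm]
  have hnorm : ∑ a, ‖v a‖ ^ 2 = ‖w‖ ^ 2 := (EuclideanSpace.norm_sq_eq w).symm
  rw [hinner, hnorm]
  calc ‖inner ℂ w (Matrix.toEuclideanCLM (n := n) (𝕜 := ℂ) A w)‖
      ≤ ‖w‖ * ‖Matrix.toEuclideanCLM (n := n) (𝕜 := ℂ) A w‖ := norm_inner_le_norm _ _
    _ ≤ ‖w‖ * (‖Matrix.toEuclideanCLM (n := n) (𝕜 := ℂ) A‖ * ‖w‖) := by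
        gcongr; exact ContinuousLinearMap.le_opNorm _ _
    _ = ‖Matrix.toEuclideanCLM (n := n) (𝕜 := ℂ) A‖ * ‖w‖ ^ 2 := by ring

theorem norm_trace_mul_le (A : Matrix n n ℂ) {R : Matrix n n ℂ} (hR : R.PosSemidef) :
    ‖(A * R).trace‖ ≤ ‖Matrix.toEuclideanCLM (n := n) (𝕜 := ℂ) A‖ * R.trace.re := by
  obtain ⟨C, rfl⟩ := exists_eq_conjTranspose_mul_self_of_posSemidef hR
  let v : n → n → ℂ := fun i => star (C i)
  have htrace : (A * (C.conjTranspose * C)).trace = ∑ i, star (v i) ⬝ᵥ A.mulVec (v i) := by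
    rw [← mul_assoc, Matrix.trace_mul_comm]
    simp [v, Matrix.trace, Matrix.mul_apply, dotProduct, Matrix.mulVec]
  have hmass : (C.conjTranspose * C).trace.re = ∑ i, ∑ a, ‖v i a‖ ^ 2 := by
    rw [Matrix.trace_mul_comm]
    simp [v, Matrix.trace, Matrix.mul_apply, Complex.mul_conj, Complex.normSq_eq_norm_sq,
      -Complex.ofReal_pow]
  rw [htrace, hmass, Finset.mul_sum]
  exact norm_sum_le_of_le _ fun i _ => norm_star_dotProduct_mulVec_le A (v i)

end TraceDuality

namespace QNN

section Gates

variable {N : ℕ}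

theorem Pauli.isHermitian_toMatrix (p : Pauli) : p.toMatrix.IsHermitian := by
  cases p <;> ext i j <;> fin_cases i <;> fin_cases j <;> simp [Pauli.toMatrix]

theorem isHermitian_pauliOn (q : Fin N) (p : Pauli) : (pauliOn q p).IsHermitian := by
  ext a b
  simp only [Matrix.conjTranspose_apply, pauliOn, Matrix.of_apply, star_prod]
  refine Finset.prod_congr rfl fun k _ => ?_
  split_ifs
  · exact p.isHermitian_toMatrix.apply _ _
  · exact Matrix.isHermitian_one.apply _ _

open scoped Matrix.Norms.L2Operator in
theorem rotation_mem_unitaryGroup (q : Fin N) (p : Pauli) (α : ℝ) :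
    rotation q p α ∈ Matrix.unitaryGroup (Basis N) ℂ := by
  let +nondep : NormedAlgebra ℚ (Op N) := .restrictScalars ℚ ℂ (Op N)
  refine NormedSpace.exp_mem_unitary_of_mem_skewAdjoint
    (IsSelfAdjoint.smul_mem_skewAdjoint ?_ (isHermitian_pauliOn q p))
  simp [skewAdjoint.mem_iff]
  ring

open scoped Matrix.Norms.L2Operator in
theorem differentiable_rotation_apply (q : Fin N) (p : Pauli) (a b : Basis N) :
    Differentiable ℝ fun α : ℝ => rotation q p α a b := by
  have hexp : Differentiable ℂ fun u : ℂ => NormedSpace.exp (u • pauliOn q p) := fun u =>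
    (hasDerivAt_exp_smul_const (pauliOn q p) u).differentiableAt
  have hentry : Differentiable ℂ fun u : ℂ => NormedSpace.exp (u • pauliOn q p) a b :=
    (Matrix.entryLinearMap ℂ ℂ a b).toContinuousLinearMap.differentiable.comp hexp
  have hangle : Differentiable ℝ fun α : ℝ => -(Complex.I * (α : ℂ) / 2) := by
    have : Differentiable ℝ fun α : ℝ => (α : ℂ) := Complex.ofRealCLM.differentiable
    fun_prop
  exact (hentry.restrictScalars ℝ).comp hangle

end Gates

section Regularity

variable {X : Type*} {A : StarSubalgebra ℂ (X → ℂ)} {N L D : ℕ} {n : Fin (L + 1) → ℕ}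

theorem TrainableBlock.toOp_mem_entrywise {k : ℕ} (W : TrainableBlock N k) {α : X → Fin k → ℝ}
    (h : ∀ i, (fun s => rotation (W.qubit i) (W.axis i) (α s i)) ∈ entrywise A) :
    (fun s => W.toOp (α s)) ∈ entrywise A := by
  refine mul_mem ?_ (const_mem_entrywise W.last.1)
  simp only [List.ofFn_eq_map]
  exact list_prod_map_mem_entrywise _ fun i => mul_mem (const_mem_entrywise (W.gate i).1) (h i)

namespace ReuploadingQNN

variable (Q : ReuploadingQNN N L D n) {θ : X → Params n} {x : X → Fin D → ℝ}

theorem circuit_mem_entrywise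
    (hθ : ∀ j q p, (fun s => rotation (N := N) q p (θ s j)) ∈ entrywise A)
    (hx : (fun s => (Q.encode (x s)).1) ∈ entrywise A) :
    (fun s => Q.circuit (θ s) (x s)) ∈ entrywise A := by
  have hblock : ∀ l, (fun s => Q.blockOp (θ s) l) ∈ entrywise A := fun l =>
    (Q.block l).toOp_mem_entrywise fun i => hθ _ _ _
  refine mul_mem ?_ (hblock 0)
  simp only [List.ofFn_eq_map, ← List.map_reverse]
  exact list_prod_map_mem_entrywise _ fun l => mul_mem (hblock _) hx

theorem trace_output_mem
    (hθ : ∀ j q p, (fun s => rotation (N := N) q p (θ s j)) ∈ entrywise A)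
    (hx : (fun s => (Q.encode (x s)).1) ∈ entrywise A) :
    (fun s => (Q.obs * (Q.circuit (θ s) (x s) * Q.rho
      * (Q.circuit (θ s) (x s)).conjTranspose)).trace) ∈ A := by
  have hcircuit := Q.circuit_mem_entrywise hθ hx
  exact trace_mem_of_mem_entrywise (mul_mem (const_mem_entrywise Q.obs)
    (mul_mem (mul_mem hcircuit (const_mem_entrywise Q.rho)) (star_mem hcircuit)))

theorem measurable_output : Measurable (Function.uncurry Q.output) := by
  refine Complex.measurable_re.comp (Q.trace_output_mem (A := measurableFunctions _)
    (θ := Prod.fst) (x := Prod.snd) (fun j q p a b => ?_) fun a b => ?_)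
  · exact (differentiable_rotation_apply q p a b).continuous.measurable.comp
      ((measurable_pi_apply j).comp measurable_fst)
  · exact (Q.encode_measurable a b).comp measurable_snd

theorem differentiable_output_update (θ : Params n) (j : Σ l, Fin (n l)) (x : Fin D → ℝ) :
    Differentiable ℝ fun s : ℝ => Q.output (Function.update θ j s) x := by
  have hupdate : ∀ i, Differentiable ℝ fun s => Function.update θ j s i := fun i => by
    rcases eq_or_ne i j with rfl | hij
    · simp
    · simp [hij]
  exact Complex.reCLM.differentiable.comp (Q.trace_output_mem (A := differentiableFunctions)
    (fun i q p a b => (differentiable_rotation_apply q p a b).comp (hupdate i))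
    (const_mem_entrywise _))

end ReuploadingQNN

end Regularity

section OutputBound

variable {N L D : ℕ} {n : Fin (L + 1) → ℕ}

theorem TrainableBlock.toOp_mem_unitaryGroup {k : ℕ} (W : TrainableBlock N k) (α : Fin k → ℝ) :
    W.toOp α ∈ Matrix.unitaryGroup (Basis N) ℂ := by
  refine mul_mem (list_prod_mem fun U hU => ?_) W.last.2
  obtain ⟨i, rfl⟩ := (List.mem_ofFn' _ _).1 hU
  exact mul_mem (W.gate i).2 (rotation_mem_unitaryGroup _ _ _)

namespace ReuploadingQNN

variable (Q : ReuploadingQNN N L D n)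

theorem circuit_mem_unitaryGroup (θ : Params n) (x : Fin D → ℝ) :
    Q.circuit θ x ∈ Matrix.unitaryGroup (Basis N) ℂ := by
  refine mul_mem (list_prod_mem fun U hU => ?_) ((Q.block 0).toOp_mem_unitaryGroup _)
  obtain ⟨l, rfl⟩ := (List.mem_ofFn' _ _).1 (List.mem_reverse.1 hU)
  exact mul_mem ((Q.block l.succ).toOp_mem_unitaryGroup _) (Q.encode x).2

theorem trace_circuit_mul_rho_mul_conjTranspose (θ : Params n) (x : Fin D → ℝ) :
    (Q.circuit θ x * Q.rho * (Q.circuit θ x).conjTranspose).trace = 1 := by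
  rw [Matrix.trace_mul_comm, ← mul_assoc, ← Matrix.star_eq_conjTranspose,
    Matrix.mem_unitaryGroup_iff'.1 (Q.circuit_mem_unitaryGroup θ x), one_mul, Q.rho_trace]

theorem abs_output_le (θ : Params n) (x : Fin D → ℝ) : |Q.output θ x| ≤ opNorm Q.obs :=
  calc |Q.output θ x|
      ≤ ‖(Q.obs * (Q.circuit θ x * Q.rho * (Q.circuit θ x).conjTranspose)).trace‖ :=
        Complex.abs_re_le_norm _
    _ ≤ opNorm Q.obs * (Q.circuit θ x * Q.rho * (Q.circuit θ x).conjTranspose).trace.re :=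
        norm_trace_mul_le _ (Q.rho_posSemidef.mul_mul_conjTranspose_same _)
    _ = opNorm Q.obs := by rw [Q.trace_circuit_mul_rho_mul_conjTranspose, Complex.one_re, mul_one]

end ReuploadingQNN

end OutputBound

end QNN

namespace QNN.ReuploadingQNN

variable {N L D : ℕ} {n : Fin (L + 1) → ℕ} (Q : ReuploadingQNN N L D n) {ℓ : ℝ → ℝ → ℝ}
  {I : Set ℝ} {C₁ : ℝ≥0}

theorem measurable_lossAt (hℓ : Measurable (Function.uncurry ℓ)) :
    Measurable (Function.uncurry (Q.lossAt ℓ)) :=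
  hℓ.comp ((Q.measurable_output.comp (measurable_fst.prodMk measurable_snd.fst)).prodMk
    measurable_snd.snd)

theorem differentiable_lossAt_update (hI : ∀ θ x, Q.output θ x ∈ I) {z : (Fin D → ℝ) × ℝ}
    (hz : DifferentiableOn ℝ (fun a => ℓ a z.2) I) (θ : Params n) (j : Σ l, Fin (n l)) :
    Differentiable ℝ fun s => Q.lossAt ℓ (Function.update θ j s) z :=
  differentiableOn_univ.1 <| hz.comp
    (Q.differentiable_output_update θ j z.1).differentiableOn fun _ _ => hI _ _

theorem abs_lossAt_sub_lossAt_le (hI : ∀ θ x, Q.output θ x ∈ I) {z : (Fin D → ℝ) × ℝ}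
    (hz : LipschitzOnWith C₁ (fun a => ℓ a z.2) I) (θ θ' : Params n) :
    |Q.lossAt ℓ θ z - Q.lossAt ℓ θ' z| ≤ 2 * C₁ * opNorm Q.obs :=
  calc |Q.lossAt ℓ θ z - Q.lossAt ℓ θ' z|
      ≤ C₁ * |Q.output θ z.1 - Q.output θ' z.1| := hz.dist_le_mul _ (hI θ z.1) _ (hI θ' z.1)
    _ ≤ C₁ * (opNorm Q.obs + opNorm Q.obs) := by
        gcongr
        exact (abs_sub _ _).trans (add_le_add (Q.abs_output_le _ _) (Q.abs_output_le _ _))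
    _ = 2 * C₁ * opNorm Q.obs := by ring

theorem expectedGap_eq_generalizationGap {P : Measure ((Fin D → ℝ) × ℝ)}
    (hint : ∀ θ, Integrable (Q.lossAt ℓ θ) P) (η : ℝ) (T : ℕ) (θ₀ : Params n) {m : ℕ}
    (S : Fin m → (Fin D → ℝ) × ℝ) :
    Q.expectedGap ℓ P η T θ₀ S
      = generalizationGap P (meanLoss (Q.lossAt ℓ) (gradientStep η (Q.lossAt ℓ)) θ₀ T) S := by
  simp only [expectedGap, risk, empiricalRisk, generalizationGap, meanLoss]
  rw [integral_div, integral_finsetSum _ fun σ _ => hint _, Finset.sum_sub_distrib, sub_div,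
    ← Finset.sum_div, ← Finset.sum_div, Finset.sum_comm, div_right_comm]
  rfl

end QNN.ReuploadingQNN

theorem isBigO_const_mul_natCast_pow (C : ℝ) :
    (fun p : ℕ × ℝ => C * (p.1 : ℝ)) =O[(⊤ : Filter ℕ) ×ˢ (atTop : Filter ℝ)]
      fun p : ℕ × ℝ => p.2 ^ p.1 := by
  refine IsBigO.of_bound |C| ?_
  filter_upwards [tendsto_snd.eventually (eventually_ge_atTop (2 : ℝ))] with ⟨T, u⟩ hu
  rw [norm_mul, Real.norm_eq_abs, norm_pow, Real.norm_natCast]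
  gcongr
  calc (T : ℝ) ≤ 2 ^ T := by exact_mod_cast Nat.lt_two_pow_self.le
    _ ≤ ‖u‖ ^ T := by gcongr; exact hu.trans (le_abs_self u)

theorem corollary1_general {N L D : ℕ} {n : Fin (L + 1) → ℕ} (Q : QNN.ReuploadingQNN N L D n)
    {ℓ : ℝ → ℝ → ℝ} {I Y : Set ℝ} {C₁ : ℝ≥0} {M b : ℝ} {P : Measure ((Fin D → ℝ) × ℝ)}
    [IsProbabilityMeasure P] (hb : QNN.opNorm Q.obs ≤ b) (hI : ∀ θ x, Q.output θ x ∈ I)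
    (hPY : ∀ᵐ z ∂P, z.2 ∈ Y) (hℓ : Measurable (Function.uncurry ℓ))
    (hlip : ∀ y ∈ Y, LipschitzOnWith C₁ (fun a => ℓ a y) I)
    (hdiff : ∀ y ∈ Y, DifferentiableOn ℝ (fun a => ℓ a y) I)
    (hbdd : ∀ y ∈ Y, ∀ a ∈ I, 0 ≤ ℓ a y ∧ ℓ a y ≤ M) (η : ℝ) (T : ℕ) (θ₀ : QNN.Params n)
    {m : ℕ} (hm : m ≠ 0) {δ : ℝ} (hδ : 0 < δ) (hδ1 : δ ≤ 1) :
    ENNReal.ofReal (1 - δ) ≤ (Measure.pi fun _ : Fin m => P)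
      {S | Q.expectedGap ℓ P η T θ₀ S ≤ b / m * (4 * C₁ * T)
        + (b * (4 * C₁ * T) + M) * √(Real.log (1 / δ) / (2 * m))} := by
  have hM : ∀ᵐ z ∂P, ∀ θ, Q.lossAt ℓ θ z ∈ Set.Icc 0 M :=
    hPY.mono fun z hz θ => hbdd _ hz _ (hI θ z.1)
  obtain ⟨z₀, hz₀⟩ := hM.exists
  lift M to ℝ≥0 using (hz₀ θ₀).1.trans (hz₀ θ₀).2
  lift b to ℝ≥0 using (norm_nonneg _).trans hb
  have hosc : ∀ᵐ z ∂P, ∀ θ θ', |Q.lossAt ℓ θ z - Q.lossAt ℓ θ' z| ≤ (2 * C₁ * b : ℝ≥0) :=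
    hPY.mono fun z hz θ θ' =>
      (Q.abs_lossAt_sub_lossAt_le hI (hlip _ hz) θ θ').trans (by push_cast; gcongr)
  have hint : ∀ θ, Integrable (Q.lossAt ℓ θ) P := fun θ =>
    .of_mem_Icc 0 M (Q.measurable_lossAt hℓ).of_uncurry_left.aemeasurable
      (hM.mono fun z hz => hz θ)
  refine (ofReal_one_sub_le_measure_generalizationGap_gradientStep_le (η := η)
    (Q.measurable_lossAt hℓ)
    (hPY.mono fun z hz θ j => Q.differentiable_lossAt_update hI (hdiff _ hz) θ j _) hM hosc
    θ₀ T hm hδ hδ1).trans (measure_mono fun S hS => ?_)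
  refine (Q.expectedGap_eq_generalizationGap hint η T θ₀ S).trans_le (le_trans hS ?_)
  calc T * (2 * C₁ * b : ℝ≥0) / m
        + (2 * T * (2 * C₁ * b : ℝ≥0) + M) * √(Real.log (1 / δ) / (2 * m))
      = b / m * (2 * C₁ * T) + (b * (4 * C₁ * T) + M) * √(Real.log (1 / δ) / (2 * m)) := by
        push_cast; ring
    _ ≤ b / m * (4 * C₁ * T) + (b * (4 * C₁ * T) + M) * √(Real.log (1 / δ) / (2 * m)) := by
        gcongr; norm_num

theorem corollary1 (C₁ C₂ : ℝ≥0) :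
    ∃ g : ℕ → ℝ → ℝ,
      ((fun p : ℕ × ℝ => g p.1 p.2) =O[(⊤ : Filter ℕ) ×ˢ (atTop : Filter ℝ)]
        fun p : ℕ × ℝ => p.2 ^ p.1) ∧
      ∀ (N L D : ℕ) (n : Fin (L + 1) → ℕ) (Q : QNN.ReuploadingQNN N L D n)
        (ℓ : ℝ → ℝ → ℝ) (I Y : Set ℝ) (M : ℝ)
        (P : Measure ((Fin D → ℝ) × ℝ)) (η : ℝ) (T : ℕ) (θ₀ : QNN.Params n) (m : ℕ) (δ : ℝ),
        1 ≤ L → 1 ≤ D → 1 ≤ m → 0 < η → 0 < δ → δ < 1 →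
        IsProbabilityMeasure P →
        I.OrdConnected → (∀ θ x, Q.output θ x ∈ I) →
        MeasurableSet Y → (∀ᵐ z ∂P, z.2 ∈ Y) →
        Measurable (Function.uncurry ℓ) →
        QNN.LipschitzSmoothBounded ℓ I Y C₁ C₂ M →
        ENNReal.ofReal (1 - δ) ≤
          (Measure.pi fun _ : Fin m => P)
            {S | Q.expectedGap ℓ P η T θ₀ S ≤
              (L * D * QNN.opNorm Q.obs) / m
                  * g T (η * QNN.numParams n * QNN.opNorm Q.obs)
                + (L * D * QNN.opNorm Q.obs * g T (η * QNN.numParams n * QNN.opNorm Q.obs) + M)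
                  * Real.sqrt (Real.log (1 / δ) / (2 * m))} := by
  refine ⟨fun T _ => 4 * C₁ * T, isBigO_const_mul_natCast_pow _, ?_⟩
  intro N L D n Q ℓ I Y M P η T θ₀ m δ hL hD hm _ hδ hδ1 _ _ hI _ hPY hℓ h
  have hLD : (1 : ℝ) ≤ L * D := by exact_mod_cast Nat.mul_pos hL hD
  exact corollary1_general Q (le_mul_of_one_le_left (norm_nonneg _) hLD) hI hPY hℓ h.lipschitz
    h.differentiable h.bounded η T θ₀ (Nat.one_le_iff_ne_zero.1 hm) hδ hδ1.le
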